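/- Let $q$ be a prime power, let $\mathrm{PG}(3,q)$ be the $3$-dimensional projective space over $\mathbb{F}_q$, let $\pi_\infty$ be a plane of $\mathrm{PG}(3,q)$, and let $\mathrm{AG}(3,q)$ be the corresponding affine space with plane at infinity $\pi_\infty$: its points are the points of $\mathrm{PG}(3,q)$ outside $\pi_\infty$, and its lines are the sets $\ell\setminus\pi_\infty$ for the lines $\ell\not\subseteq\pi_\infty$ of $\mathrm{PG}(3,q)$. In either space, a line spread is a set of pairwise disjoint lines that partitions the points of that space, and a Cameron–Liebler line class of parameter $x$ is a set of lines that has exactly $x$ lines in common with every line spread $\mathcal{S}$ of that space. Let $\mathcal{L}$ be a Cameron–Liebler line class of parameter $x$ in $\mathrm{PG}(3,q)$. Then the restriction $\{\ell\setminus\pi_\infty : \ell\in\mathcal{L},\ \ell\not\subseteq\pi_\infty\}$ of $\mathcal{L}$ to $\mathrm{AG}(3,q)$ is a Cameron–Liebler line class of $\mathrm{AG}(3,q)$ with the same parameter $x$ if and only if $\mathcal{L}$ contains no line of the plane $\pi_\infty$. -/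

import Mathlib

open scoped LinearAlgebra.Projectivization

section Spreads

variable {P : Type*}

/-- A line spread of a point-line geometry on the point set `P`, whose lines are given as sets of
points: a set of pairwise disjoint lines that covers all points. -/
def IsLineSpread (lines S : Set (Set P)) : Prop :=
  S ⊆ lines ∧ S.PairwiseDisjoint id ∧ ⋃₀ S = Set.univ

/-- A Cameron-Liebler line class of parameter `x`: a set of lines that meets every line spread
in exactly `x` lines. -/
def IsCLLineClass (lines : Set (Set P)) (x : ℕ) (L : Set (Set P)) : Prop :=
  L ⊆ lines ∧ ∀ S, IsLineSpread lines S → (L ∩ S).ncard = x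

end Spreads

section Geometry

variable {F V : Type*} [Field F] [AddCommGroup V] [Module F V]

/-- The set of points of the projective space `ℙ F V` that lie in the projective subspace
given by the vector subspace `W`. -/
def projPoints (W : Submodule F V) : Set (ℙ F V) :=
  {p | p.submodule ≤ W}

variable (F V) in
/-- The lines of the projective space `ℙ F V`, as sets of points. -/
def projLines : Set (Set (ℙ F V)) :=
  {l | ∃ W : Submodule F V, Module.finrank F W = 2 ∧ l = projPoints W}

/-- The lines of `ℙ F V` that lie in the hyperplane at infinity `H`. -/
def linesAtInfinity (H : Submodule F V) : Set (Set (ℙ F V)) :=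
  {l | l ∈ projLines F V ∧ l ⊆ projPoints H}

/-- The points of the affine space obtained from `ℙ F V` by deleting the hyperplane `H`. -/
abbrev AffPoint (H : Submodule F V) : Type _ :=
  {p : ℙ F V // p ∉ projPoints H}

/-- The restriction of a set of projective lines to the affine space with hyperplane at
infinity `H`: the affine parts of those members that do not lie in `H`. -/
def affRestrict (H : Submodule F V) (L : Set (Set (ℙ F V))) : Set (Set (AffPoint H)) :=
  {m | ∃ l ∈ L, l ∉ linesAtInfinity H ∧ m = Subtype.val ⁻¹' l}

/-- The lines of the affine space with hyperplane at infinity `H`: the affine parts of the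
projective lines that do not lie in `H`. -/
def affLines (H : Submodule F V) : Set (Set (AffPoint H)) :=
  affRestrict H (projLines F V)

end Geometry

/-! The key fact is `IsCLLineClass.exists_weight`: there is a weight `b` on the points whose sum
over any projective line is `A > 0` if the line is in `L` and `0` otherwise. It comes from averaging
over the translates of a regular spread: with `V` identified with `E × E`, `E` the quadratic
extension of `F`, this gives the number of lines of `L` skew to a given line.

If `L` has no line in `H`, all line sums of `b` in the plane `H` vanish, hence `b = 0` on `H`
(`eq_zero_of_line_sums_eq_zero`). The lines of an affine spread may meet at infinity, but they cover
each point outside `H` exactly once, so they carry the same total weight `A * x` as a projective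
spread.

Conversely, a line of `L` in `H` extends to a projective spread. The affine part of that spread is
an affine spread that has lost this line, so it meets the restriction in fewer than `x` lines. -/

open Module

/-! ### Points and lines: intersections, double counting, weights on a plane. -/

section Incidence

variable {F V : Type*} [Field F] [AddCommGroup V] [Module F V]

theorem mk_mem_projPoints {W : Submodule F V} {v : V} (hv : v ≠ 0) :
    Projectivization.mk F v hv ∈ projPoints W ↔ v ∈ W := by
  simp [projPoints, Submodule.span_singleton_le_iff_mem]

theorem projPoints_subset_iff {W U : Submodule F V} :
    projPoints W ⊆ projPoints U ↔ W ≤ U := by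
  refine ⟨fun h v hv => ?_, fun h p hp => le_trans hp h⟩
  by_cases h0 : v = 0
  · simp [h0]
  · exact (mk_mem_projPoints h0).1 (h ((mk_mem_projPoints h0).2 hv))

theorem projPoints_injective :
    Function.Injective (projPoints : Submodule F V → Set (ℙ F V)) := fun _ _ h =>
  le_antisymm (projPoints_subset_iff.1 h.le) (projPoints_subset_iff.1 h.ge)

theorem exists_mem_projPoints_of_not_le {W U : Submodule F V} (h : ¬ W ≤ U) :
    ∃ p ∈ projPoints W, p ∉ projPoints U :=
  Set.not_subset.1 (mt projPoints_subset_iff.1 h)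

/-- A projective line that is not at infinity is determined by its affine points. -/
theorem affPart_injOn (H : Submodule F V) :
    Set.InjOn (fun W : Submodule F V => (Subtype.val ⁻¹' projPoints W : Set (AffPoint H)))
      {W | ¬ W ≤ H} := by
  have key : ∀ W U : Submodule F V, ¬ W ≤ H →
      (Subtype.val ⁻¹' projPoints W : Set (AffPoint H)) ⊆ Subtype.val ⁻¹' projPoints U →
      W ≤ U := by
    intro W U hW h
    have haff : ∀ v ∈ W, v ∉ H → v ∈ U := by
      intro v hv hvH
      have h0 : v ≠ 0 := fun h0 => hvH (h0 ▸ H.zero_mem)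
      have := @h ⟨Projectivization.mk F v h0, mt (mk_mem_projPoints h0).1 hvH⟩
        ((mk_mem_projPoints h0).2 hv)
      exact (mk_mem_projPoints h0).1 this
    -- A vector of `W ⊓ H` is the difference of the vectors `v + w` and `w` of `W`, both outside
    -- `H`.
    obtain ⟨w, hw, hwH⟩ := SetLike.not_le_iff_exists.1 hW
    intro v hv
    by_cases hvH : v ∈ H
    · have h1 := haff (v + w) (W.add_mem hv hw) (fun h => hwH ((H.add_mem_iff_right hvH).1 h))
      simpa using U.sub_mem h1 (haff w hw hwH)
    · exact haff v hv hvH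
  exact fun W hW U hU h => le_antisymm (key W U hW h.le) (key U W hU h.ge)

theorem finrank_sup_submodule {p p' : ℙ F V} (h : p ≠ p') :
    finrank F (p.submodule ⊔ p'.submodule : Submodule F V) = 2 := by
  have hp := p.finrank_submodule
  have hp' := p'.finrank_submodule
  have : FiniteDimensional F p.submodule := .of_finrank_pos (by omega)
  have : FiniteDimensional F p'.submodule := .of_finrank_pos (by omega)
  have h1 := Submodule.finrank_sup_add_finrank_inf_eq p.submodule p'.submodule
  have h2 : finrank F (p.submodule ⊓ p'.submodule : Submodule F V) = 0 := by
    by_contra h0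
    have hle := Submodule.finrank_mono (inf_le_left : p.submodule ⊓ p'.submodule ≤ p.submodule)
    have e1 := Submodule.eq_of_le_of_finrank_eq
      (inf_le_left : p.submodule ⊓ p'.submodule ≤ p.submodule) (by omega)
    have e2 := Submodule.eq_of_le_of_finrank_eq
      (inf_le_right : p.submodule ⊓ p'.submodule ≤ p'.submodule) (by omega)
    exact h (Projectivization.submodule_injective (e1.symm.trans e2))
  omega

theorem exists_finrank_eq_two (hV : 2 ≤ finrank F V) :
    ∃ W : Submodule F V, finrank F W = 2 := by
  have hlt : ∀ K : Submodule F V, finrank F K ≤ 1 → ¬ ⊤ ≤ K := fun K hK hle => by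
    rw [top_le_iff.1 hle, finrank_top] at hK
    omega
  obtain ⟨p, -, -⟩ := exists_mem_projPoints_of_not_le (hlt ⊥ (by simp))
  obtain ⟨p', -, hp'⟩ := exists_mem_projPoints_of_not_le (hlt p.submodule p.finrank_submodule.le)
  refine ⟨p.submodule ⊔ p'.submodule, finrank_sup_submodule ?_⟩
  rintro rfl
  exact hp' (le_refl p.submodule)

theorem eq_sup_submodule {p p' : ℙ F V} (h : p ≠ p') {W : Submodule F V} (hW : finrank F W = 2)
    (hp : p ∈ projPoints W) (hp' : p' ∈ projPoints W) : W = p.submodule ⊔ p'.submodule := by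
  have : FiniteDimensional F W := .of_finrank_pos (by omega)
  exact (Submodule.eq_of_le_of_finrank_eq (sup_le hp hp')
    (by rw [finrank_sup_submodule h, hW])).symm

theorem disjoint_iff_projPoints {U W : Submodule F V} :
    Disjoint U W ↔ ∀ p, p ∈ projPoints U → p ∉ projPoints W := by
  rw [Submodule.disjoint_def]
  constructor
  · intro h p hp hp'
    induction p using Projectivization.ind with | h v hv =>
    exact hv (h v ((mk_mem_projPoints hv).1 hp) ((mk_mem_projPoints hv).1 hp'))
  · intro h v hv hv'
    by_contra h0
    exact h _ ((mk_mem_projPoints h0).2 hv) ((mk_mem_projPoints h0).2 hv')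

theorem card_projPoints [Finite F] {W : Submodule F V} (hW : finrank F W = 2) :
    Nat.card (projPoints W) = Nat.card F + 1 := by
  rw [← Projectivization.card_of_finrank_two F W hW]
  have hmem : ∀ p : ℙ F W,
      Projectivization.map W.subtype W.injective_subtype p ∈ projPoints W := by
    intro p
    induction p using Projectivization.ind with | h v hv =>
    rw [Projectivization.map_mk]
    exact (mk_mem_projPoints _).2 v.2
  refine (Nat.card_congr (Equiv.ofBijective (fun p => ⟨_, hmem p⟩) ⟨?_, ?_⟩)).symm
  · intro p p' h
    exact Projectivization.map_injective _ W.injective_subtype (congrArg Subtype.val h)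
  · rintro ⟨p, hp⟩
    induction p using Projectivization.ind with | h v hv =>
    refine ⟨Projectivization.mk F ⟨v, (mk_mem_projPoints hv).1 hp⟩ (by simpa using hv), ?_⟩
    simp [Projectivization.map_mk]

-- A single formula for the intersection sizes `q + 1`, `1` and `0` lets a count over all lines
-- split into three sums.
open Classical in
theorem card_inter_projPoints [Finite F] [Fintype (ℙ F V)] {U W : Submodule F V}
    (hU : finrank F U = 2) (hW : finrank F W = 2) :
    (({p | p ∈ projPoints U ∧ p ∈ projPoints W} : Finset (ℙ F V)).card : ℚ) =
      1 + (if U = W then (Nat.card F : ℚ) else 0) - (if Disjoint U W then 1 else 0) := by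
  by_cases hd : Disjoint U W
  · have hne : U ≠ W := by
      rintro rfl
      rw [disjoint_self] at hd
      rw [hd, finrank_bot] at hU
      omega
    rw [Finset.filter_false_of_mem]
    · simp [hd, hne]
    · rintro p - ⟨h1, h2⟩
      exact disjoint_iff_projPoints.1 hd p h1 h2
  · by_cases he : U = W
    · subst he
      have := card_projPoints hU
      rw [Nat.card_eq_fintype_card, Fintype.card_subtype] at this
      simp only [and_self, if_true, if_neg hd]
      rw [this]
      push_cast
      ring
    · obtain ⟨p, hp, hp'⟩ : ∃ p, p ∈ projPoints U ∧ p ∈ projPoints W := by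
        simpa [disjoint_iff_projPoints] using hd
      have : ({p | p ∈ projPoints U ∧ p ∈ projPoints W} : Finset (ℙ F V)) = {p} := by
        ext p'
        simp only [Finset.mem_filter, Finset.mem_univ, true_and, Finset.mem_singleton]
        constructor
        · rintro ⟨h1, h2⟩
          by_contra hne
          exact he ((eq_sup_submodule hne hU h1 hp).trans (eq_sup_submodule hne hW h2 hp').symm)
        · rintro rfl
          exact ⟨hp, hp'⟩
      rw [this]
      simp [he, hd]

open Classical in
/-- Double counting of the incidences between a set of lines and the points of the space. -/
theorem sum_lines_sum_points [Fintype (ℙ F V)] (S : Finset (Submodule F V)) (b : ℙ F V → ℚ) :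
    ∑ W ∈ S, ∑ p with p ∈ projPoints W, b p =
      ∑ p, ({W ∈ S | p ∈ projPoints W}.card : ℚ) * b p := by
  simp_rw [Finset.sum_filter]
  rw [Finset.sum_comm]
  refine Finset.sum_congr rfl fun p _ => ?_
  rw [← Finset.sum_filter, Finset.sum_const, nsmul_eq_mul]

-- Unique covering is required only on the support of `b`, so that lines meeting where `b` vanishes
-- are allowed.
open Classical in
theorem sum_lines_eq_sum_points [Fintype (ℙ F V)] {S : Finset (Submodule F V)} {b : ℙ F V → ℚ}
    (h : ∀ p, b p ≠ 0 → ∃! W, W ∈ S ∧ p ∈ projPoints W) :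
    ∑ W ∈ S, ∑ p with p ∈ projPoints W, b p = ∑ p, b p := by
  rw [sum_lines_sum_points]
  refine Finset.sum_congr rfl fun p _ => ?_
  by_cases hb : b p = 0
  · simp [hb]
  · obtain ⟨W, hW, hu⟩ := h p hb
    have : {W ∈ S | p ∈ projPoints W} = {W} := by
      ext U
      simp only [Finset.mem_filter, Finset.mem_singleton]
      exact ⟨hu U, by rintro rfl; exact hW⟩
    simp [this]

open Classical in
/-- The point-line incidence matrix of a projective plane has trivial kernel. -/
theorem eq_zero_of_line_sums_eq_zero [Finite V] [Fintype (ℙ F V)] {H : Submodule F V}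
    (hH : finrank F H = 3) {b : ℙ F V → ℚ}
    (h : ∀ W : Submodule F V, finrank F W = 2 → W ≤ H → ∑ p with p ∈ projPoints W, b p = 0)
    {p : ℙ F V} (hp : p ∈ projPoints H) : b p = 0 := by
  have := Fintype.ofFinite (Submodule F V)
  let pencil (p : ℙ F V) : Finset (Submodule F V) :=
    {W | finrank F W = 2 ∧ W ≤ H ∧ p ∈ projPoints W}
  have hpencil : ∀ p W, W ∈ pencil p ↔ finrank F W = 2 ∧ W ≤ H ∧ p ∈ projPoints W := by
    simp [pencil]
  set B : ℚ := ∑ p with p ∈ projPoints H, b p with hB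
  have hcard : ∀ p ∈ projPoints H, 2 ≤ (pencil p).card := by
    intro p hp
    have hlt : ∀ K : Submodule F V, finrank F K ≤ 2 → ¬ H ≤ K := fun K hK hle => by
      have := Submodule.finrank_mono hle
      omega
    obtain ⟨p₁, h₁, h₁'⟩ := exists_mem_projPoints_of_not_le
      (hlt p.submodule (by rw [p.finrank_submodule]; norm_num))
    have hne₁ : p ≠ p₁ := by
      rintro rfl
      exact h₁' (le_refl p.submodule)
    obtain ⟨p₂, h₂, h₂'⟩ := exists_mem_projPoints_of_not_le
      (hlt (p.submodule ⊔ p₁.submodule) (finrank_sup_submodule hne₁).le)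
    have hne₂ : p ≠ p₂ := by
      rintro rfl
      exact h₂' (le_sup_left : p.submodule ≤ _)
    refine Finset.one_lt_card.2 ⟨p.submodule ⊔ p₁.submodule, ?_, p.submodule ⊔ p₂.submodule, ?_, ?_⟩
    · exact (hpencil _ _).2 ⟨finrank_sup_submodule hne₁, sup_le hp h₁,
        (le_sup_left : p.submodule ≤ _)⟩
    · exact (hpencil _ _).2 ⟨finrank_sup_submodule hne₂, sup_le hp h₂,
        (le_sup_left : p.submodule ≤ _)⟩
    · intro he
      exact h₂' (show p₂.submodule ≤ _ from he ▸ le_sup_right)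
  -- Summing over the pencil of `p` counts `p` once per line of the pencil and every other point of
  -- `H` once.
  have hpoint : ∀ p ∈ projPoints H, B + ((pencil p).card - 1 : ℚ) * b p = 0 := by
    intro p hp
    have h0 : ∑ W ∈ pencil p, ∑ p with p ∈ projPoints W, b p = 0 :=
      Finset.sum_eq_zero fun W hW => h W ((hpencil _ _).1 hW).1 ((hpencil _ _).1 hW).2.1
    rw [sum_lines_sum_points] at h0
    have hterm : ∀ p', ({W ∈ pencil p | p' ∈ projPoints W}.card : ℚ) * b p' =
        (if p' ∈ projPoints H then b p' else 0) +
          (if p' = p then ((pencil p).card - 1 : ℚ) * b p' else 0) := by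
      intro p'
      by_cases hpp : p' = p
      · subst hpp
        rw [Finset.filter_true_of_mem fun W hW => ((hpencil _ _).1 hW).2.2]
        simp only [hp, if_true]
        ring
      · by_cases hpH : p' ∈ projPoints H
        · have : {W ∈ pencil p | p' ∈ projPoints W} = {p'.submodule ⊔ p.submodule} := by
            ext W
            simp only [Finset.mem_filter, Finset.mem_singleton, hpencil]
            constructor
            · rintro ⟨⟨h1, -, h2⟩, h3⟩
              exact eq_sup_submodule hpp h1 h3 h2
            · rintro rfl
              exact ⟨⟨finrank_sup_submodule hpp, sup_le hpH hp, (le_sup_right : p.submodule ≤ _)⟩,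
                (le_sup_left : p'.submodule ≤ _)⟩
          simp [this, hpp, hpH]
        · rw [Finset.filter_false_of_mem]
          · simp [hpp, hpH]
          · intro W hW hpW
            exact hpH (le_trans hpW ((hpencil _ _).1 hW).2.1)
    simp_rw [hterm, Finset.sum_add_distrib] at h0
    rw [← Finset.sum_filter, Finset.sum_ite_eq' Finset.univ p] at h0
    simpa using h0
  have hpos : ∀ p ∈ projPoints H, (0 : ℚ) < (pencil p).card - 1 := by
    intro p hp
    have : (2 : ℚ) ≤ (pencil p).card := by exact_mod_cast hcard p hp
    linarith
  have hb : ∀ p ∈ projPoints H, b p = -B * (1 / ((pencil p).card - 1 : ℚ)) := by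
    intro p hp
    have h1 := hpos p hp
    have h2 := hpoint p hp
    field_simp
    linarith
  -- Summing the formula for `b p` over `H` gives `B` times a positive factor equal to `0`.
  have hB0 : B = 0 := by
    have h1 : B = -B * ∑ p with p ∈ projPoints H, (1 / ((pencil p).card - 1 : ℚ)) := by
      rw [Finset.mul_sum]
      exact Finset.sum_congr rfl fun p hp => hb p (by simpa using hp)
    have h2 : 0 ≤ ∑ p with p ∈ projPoints H, (1 / ((pencil p).card - 1 : ℚ)) :=
      Finset.sum_nonneg fun p hp => (one_div_pos.2 (hpos p (by simpa using hp))).le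
    have h3 : B * (1 + ∑ p with p ∈ projPoints H, (1 / ((pencil p).card - 1 : ℚ))) = 0 := by
      linarith
    exact (mul_eq_zero.1 h3).resolve_right (by linarith)
  rw [hb p hp, hB0]
  simp

/-- A set of `2`-dimensional subspaces such that each point lies in exactly one of them. -/
theorem isLineSpread_image {S : Set (Submodule F V)} (h2 : ∀ W ∈ S, finrank F W = 2)
    (h : ∀ p : ℙ F V, ∃! W, W ∈ S ∧ p ∈ projPoints W) :
    IsLineSpread (projLines F V) (projPoints '' S) := by
  refine ⟨?_, ?_, ?_⟩
  · rintro _ ⟨W, hW, rfl⟩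
    exact ⟨W, h2 W hW, rfl⟩
  · rintro _ ⟨W, hW, rfl⟩ _ ⟨U, hU, rfl⟩ hne
    refine Set.disjoint_left.2 fun p hp hp' => hne ?_
    rw [(h p).unique ⟨hW, hp⟩ ⟨hU, hp'⟩]
  · refine Set.eq_univ_of_forall fun p => ?_
    obtain ⟨W, ⟨hW, hp⟩, -⟩ := h p
    exact ⟨_, ⟨W, hW, rfl⟩, hp⟩

end Incidence

/-! ### Characteristic functions of line classes. -/

section LineIndicator

variable {F V : Type*} [Field F] [AddCommGroup V] [Module F V]

open Classical in
/-- The characteristic function of a set of lines, on subspaces. -/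
noncomputable def lineIndicator (L : Set (Set (ℙ F V))) (W : Submodule F V) : ℚ :=
  if projPoints W ∈ L then 1 else 0

theorem ncard_inter_image {L : Set (Set (ℙ F V))} (S : Finset (Submodule F V)) :
    ((L ∩ projPoints '' (S : Set (Submodule F V))).ncard : ℚ) = ∑ W ∈ S, lineIndicator L W := by
  classical
  have : L ∩ projPoints '' (S : Set (Submodule F V)) =
      projPoints '' (({W ∈ S | projPoints W ∈ L} : Finset _) : Set (Submodule F V)) := by
    ext l
    constructor
    · rintro ⟨hl, W, hW, rfl⟩
      exact ⟨W, by simpa using ⟨hW, hl⟩, rfl⟩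
    · rintro ⟨W, hW, rfl⟩
      have hW' : W ∈ S ∧ projPoints W ∈ L := by simpa using hW
      exact ⟨hW'.2, W, hW'.1, rfl⟩
  rw [this, Set.ncard_image_of_injective _ projPoints_injective, Set.ncard_coe_finset]
  simp [lineIndicator]

theorem IsCLLineClass.sum_lineIndicator {L : Set (Set (ℙ F V))} {x : ℕ}
    (hL : IsCLLineClass (projLines F V) x L) {S : Finset (Submodule F V)}
    (h2 : ∀ W ∈ S, finrank F W = 2) (h : ∀ p : ℙ F V, ∃! W, W ∈ S ∧ p ∈ projPoints W) :
    ∑ W ∈ S, lineIndicator L W = x := by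
  rw [← ncard_inter_image, hL.2 _ (isLineSpread_image h2 h)]

end LineIndicator

/-! ### Lines as graphs, regular spreads, and the count of skew lines. -/

section GraphLines

variable {F V E : Type*} [Field F] [AddCommGroup V] [Module F V] [Field E] [Algebra F E]

/-- The subspace of `V` that is the graph of `T` in the coordinates `e`. -/
def graphLine (e : (E × E) ≃ₗ[F] V) (T : E →ₗ[F] E) : Submodule F V :=
  T.graph.map (e : (E × E) →ₗ[F] V)

/-- The subspace of `V` that is the second factor in the coordinates `e`. -/
def verticalLine (e : (E × E) ≃ₗ[F] V) : Submodule F V :=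
  (LinearMap.ker (LinearMap.fst F E E)).map (e : (E × E) →ₗ[F] V)

theorem apply_mem_graphLine {e : (E × E) ≃ₗ[F] V} {T : E →ₗ[F] E} {a : E × E} :
    e a ∈ graphLine e T ↔ a.2 = T a.1 := by
  unfold graphLine
  rw [Submodule.mem_map]
  constructor
  · rintro ⟨y, hy, h⟩
    obtain rfl := e.injective h
    exact hy
  · exact fun h => ⟨a, h, rfl⟩

theorem apply_mem_verticalLine {e : (E × E) ≃ₗ[F] V} {a : E × E} :
    e a ∈ verticalLine e ↔ a.1 = 0 := by
  unfold verticalLine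
  rw [Submodule.mem_map]
  constructor
  · rintro ⟨y, hy, h⟩
    obtain rfl := e.injective h
    exact hy
  · exact fun h => ⟨a, h, rfl⟩

theorem finrank_graphLine (e : (E × E) ≃ₗ[F] V) (T : E →ₗ[F] E) :
    finrank F (graphLine e T) = finrank F E := by
  unfold graphLine
  rw [LinearEquiv.finrank_map_eq, LinearMap.graph_eq_range_prod]
  exact LinearMap.finrank_range_of_inj fun a b h => congrArg Prod.fst h

theorem graphLine_injective (e : (E × E) ≃ₗ[F] V) : Function.Injective (graphLine e) := by
  intro T T' h
  ext a
  have : e (a, T a) ∈ graphLine e T' := h ▸ apply_mem_graphLine.2 rfl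
  exact apply_mem_graphLine.1 this

theorem disjoint_graphLine_verticalLine (e : (E × E) ≃ₗ[F] V) (T : E →ₗ[F] E) :
    Disjoint (graphLine e T) (verticalLine e) := by
  rw [Submodule.disjoint_def]
  intro v h1 h2
  obtain ⟨a, rfl⟩ := e.surjective v
  rw [apply_mem_graphLine] at h1
  rw [apply_mem_verticalLine] at h2
  rw [h2, map_zero] at h1
  rw [show a = 0 from Prod.ext h2 h1, map_zero]

/-- Being skew to the vertical line makes the first projection injective on `U`, hence bijective by
dimension. -/
theorem exists_eq_graphLine [FiniteDimensional F E] (e : (E × E) ≃ₗ[F] V) {U : Submodule F V}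
    (hU : finrank F U = finrank F E) (hd : Disjoint U (verticalLine e)) :
    ∃ T, U = graphLine e T := by
  let f : U →ₗ[F] E × E := (e.symm : V →ₗ[F] E × E) ∘ₗ U.subtype
  have hinj : Function.Injective (LinearMap.fst F E E ∘ₗ f) := by
    rw [← LinearMap.ker_eq_bot, LinearMap.ker_eq_bot']
    intro u hu
    have : (u : V) ∈ verticalLine e := by
      rw [← e.apply_symm_apply (u : V), apply_mem_verticalLine]
      exact hu
    exact Subtype.ext (Submodule.disjoint_def.1 hd u u.2 this)
  have : FiniteDimensional F U := FiniteDimensional.of_injective _ hinj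
  obtain ⟨T, hT⟩ := f.exists_range_eq_graph
    ((LinearMap.injective_iff_surjective_of_finrank_eq_finrank hU).1 hinj)
    (fun u v h => by rw [hinj (a₁ := u) (a₂ := v) h])
  refine ⟨T, ?_⟩
  unfold graphLine
  rw [← hT]
  ext v
  simp [f]

/-- The coordinates can be chosen such that a given line is vertical. -/
theorem exists_eq_verticalLine (hE : finrank F E = 2) (hV : finrank F V = 4)
    {W : Submodule F V} (hW : finrank F W = 2) :
    ∃ e : (E × E) ≃ₗ[F] V, W = verticalLine e := by
  have : FiniteDimensional F V := .of_finrank_pos (by omega)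
  have : FiniteDimensional F E := .of_finrank_pos (by omega)
  obtain ⟨U, hU⟩ := W.exists_isCompl
  have hU2 : finrank F U = 2 := by
    have := Submodule.finrank_add_eq_of_isCompl hU
    omega
  let eU : E ≃ₗ[F] U := LinearEquiv.ofFinrankEq _ _ (by omega)
  let eW : E ≃ₗ[F] W := LinearEquiv.ofFinrankEq _ _ (by omega)
  let e : (E × E) ≃ₗ[F] V :=
    (eU.prodCongr eW).trans (Submodule.prodEquivOfIsCompl U W hU.symm)
  refine ⟨e, (Submodule.eq_of_le_of_finrank_eq ?_ ?_).symm⟩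
  · rintro _ ⟨a, ha, rfl⟩
    have ha : a.1 = 0 := ha
    simp [e, ha]
  · unfold verticalLine
    rw [LinearEquiv.finrank_map_eq, hW, ← hE]
    have := LinearMap.finrank_range_add_finrank_ker (LinearMap.fst F E E)
    rw [LinearMap.range_eq_top.2 LinearMap.fst_surjective, finrank_top, finrank_prod] at this
    omega

/-- The lines of a translate of the regular spread. -/
noncomputable def regularSpread [Fintype E] (e : (E × E) ≃ₗ[F] V) (T : E →ₗ[F] E) :
    Finset (Submodule F V) := by
  classical
  exact insert (verticalLine e) (Finset.univ.image fun c : E =>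
    graphLine e (LinearMap.mulLeft F c + T))

theorem mem_regularSpread [Fintype E] {e : (E × E) ≃ₗ[F] V} {T : E →ₗ[F] E}
    {U : Submodule F V} : U ∈ regularSpread e T ↔
      U = verticalLine e ∨ ∃ c : E, graphLine e (LinearMap.mulLeft F c + T) = U := by
  classical
  simp [regularSpread]

/-- A vector `(a, b)` with `a ≠ 0` lies on the graph for `c = (b - T a) / a` only; division in the
field `E` is what makes this a spread. -/
theorem existsUnique_mem_regularSpread [Fintype E] (e : (E × E) ≃ₗ[F] V) (T : E →ₗ[F] E)
    (p : ℙ F V) : ∃! W, W ∈ regularSpread e T ∧ p ∈ projPoints W := by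
  induction p using Projectivization.ind with | h v hv =>
  simp only [mk_mem_projPoints]
  obtain ⟨a, rfl⟩ := e.surjective v
  have ha : a ≠ 0 := by
    rintro rfl
    simp at hv
  by_cases h1 : a.1 = 0
  · refine ⟨verticalLine e, ⟨mem_regularSpread.2 (.inl rfl), apply_mem_verticalLine.2 h1⟩, ?_⟩
    rintro U ⟨hU, haU⟩
    obtain rfl | ⟨c, rfl⟩ := mem_regularSpread.1 hU
    · rfl
    · rw [apply_mem_graphLine, h1, map_zero] at haU
      exact absurd (Prod.ext h1 haU) ha
  · refine ⟨graphLine e (LinearMap.mulLeft F ((a.2 - T a.1) / a.1) + T),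
      ⟨mem_regularSpread.2 (.inr ⟨_, rfl⟩), ?_⟩, ?_⟩
    · rw [apply_mem_graphLine]
      simp [h1]
    · rintro U ⟨hU, haU⟩
      obtain rfl | ⟨c, rfl⟩ := mem_regularSpread.1 hU
      · exact absurd (apply_mem_verticalLine.1 haU) h1
      · rw [apply_mem_graphLine] at haU
        rw [haU]
        simp [h1]

theorem finrank_of_mem_regularSpread [Fintype E] (hE : finrank F E = 2)
    {e : (E × E) ≃ₗ[F] V} (hv : finrank F (verticalLine e) = 2) {T : E →ₗ[F] E}
    {U : Submodule F V} (hU : U ∈ regularSpread e T) : finrank F U = 2 := by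
  obtain rfl | ⟨c, rfl⟩ := mem_regularSpread.1 hU
  · exact hv
  · rw [finrank_graphLine, hE]

theorem sum_regularSpread [Fintype E] (e : (E × E) ≃ₗ[F] V) (T : E →ₗ[F] E)
    (χ : Submodule F V → ℚ) :
    ∑ U ∈ regularSpread e T, χ U =
      χ (verticalLine e) + ∑ c : E, χ (graphLine e (LinearMap.mulLeft F c + T)) := by
  classical
  unfold regularSpread
  rw [Finset.sum_insert, Finset.sum_image]
  · intro c _ c' _ h
    have := graphLine_injective e h
    simpa using LinearMap.congr_fun this 1
  · simp only [Finset.mem_image, Finset.mem_univ, true_and, not_exists]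
    intro c h
    have := disjoint_graphLine_verticalLine e (LinearMap.mulLeft F c + T)
    have h1 : e (1, (LinearMap.mulLeft F c + T) 1) ∈ verticalLine e :=
      h ▸ apply_mem_graphLine.2 rfl
    simpa using apply_mem_verticalLine.1 h1

open Classical in
/-- The number of lines of a Cameron-Liebler line class that are skew to a given line. -/
theorem IsCLLineClass.sum_skew [Fintype E] [Fintype (Submodule F V)] [Fintype (E →ₗ[F] E)]
    (hE : finrank F E = 2)
    (hV : finrank F V = 4) {L : Set (Set (ℙ F V))} {x : ℕ}
    (hL : IsCLLineClass (projLines F V) x L) {W : Submodule F V} (hW : finrank F W = 2) :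
    ∑ U ∈ Finset.univ.filter (fun U : Submodule F V => finrank F U = 2 ∧ Disjoint U W),
      lineIndicator L U =
      (Fintype.card (E →ₗ[F] E) / Fintype.card E : ℚ) * (x - lineIndicator L W) := by
  have : FiniteDimensional F E := .of_finrank_pos (by omega)
  obtain ⟨e, rfl⟩ := exists_eq_verticalLine (E := E) hE hV hW
  have h1 : ∑ U ∈ Finset.univ.filter
      (fun U : Submodule F V => finrank F U = 2 ∧ Disjoint U (verticalLine e)),
      lineIndicator L U = ∑ T : E →ₗ[F] E, lineIndicator L (graphLine e T) := by
    rw [← Finset.sum_image (s := Finset.univ) (g := graphLine e) (f := lineIndicator L)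
      (fun _ _ _ _ h => graphLine_injective e h)]
    congr 1
    ext U
    simp only [Finset.mem_filter, Finset.mem_univ, true_and, Finset.mem_image]
    constructor
    · rintro ⟨h2, hd⟩
      obtain ⟨T, hT⟩ := exists_eq_graphLine e (h2.trans hE.symm) hd
      exact ⟨T, hT.symm⟩
    · rintro ⟨T, rfl⟩
      exact ⟨(finrank_graphLine e T).trans hE, disjoint_graphLine_verticalLine e T⟩
  -- Each translate of the regular spread contributes `x`.
  have h2 : ∑ T : E →ₗ[F] E, ∑ U ∈ regularSpread e T, lineIndicator L U =
      Fintype.card (E →ₗ[F] E) * (x : ℚ) := by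
    rw [Finset.sum_congr rfl fun T _ => hL.sum_lineIndicator
      (fun U hU => finrank_of_mem_regularSpread hE hW hU) (existsUnique_mem_regularSpread e T)]
    simp
  simp_rw [sum_regularSpread] at h2
  rw [Finset.sum_add_distrib,
    Finset.sum_comm (s := (Finset.univ : Finset (E →ₗ[F] E))) (t := (Finset.univ : Finset E))] at h2
  -- For fixed `c` the translation by `c` permutes the maps `T`, so every skew line is counted
  -- `Fintype.card E` times.
  have h3 : ∀ c : E, ∑ T : E →ₗ[F] E, lineIndicator L (graphLine e (LinearMap.mulLeft F c + T)) =
      ∑ T : E →ₗ[F] E, lineIndicator L (graphLine e T) := fun c =>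
    Equiv.sum_comp (Equiv.addLeft (LinearMap.mulLeft F c)) fun T => lineIndicator L (graphLine e T)
  simp_rw [h3] at h2
  rw [h1]
  simp only [Finset.sum_const, Finset.card_univ, nsmul_eq_mul] at h2
  have : (Fintype.card E : ℚ) ≠ 0 := by exact_mod_cast Fintype.card_ne_zero
  field_simp
  linarith

end GraphLines

/-! ### Passing from projective to affine spreads. -/

section AffinePart

variable {F V : Type*} [Field F] [AddCommGroup V] [Module F V]

/-- Restricting a projective line spread to the affine space, after removal of a line at
infinity. -/
theorem isLineSpread_affPart {H : Submodule F V} {S : Finset (Submodule F V)}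
    (h2 : ∀ W ∈ S, finrank F W = 2) (h : ∀ p : ℙ F V, ∃! W, W ∈ S ∧ p ∈ projPoints W) :
    IsLineSpread (affLines H) ((fun W : Submodule F V =>
      (Subtype.val ⁻¹' projPoints W : Set (AffPoint H))) '' {W | W ∈ S ∧ ¬ W ≤ H}) := by
  refine ⟨?_, ?_, ?_⟩
  · rintro _ ⟨W, ⟨hW, hWH⟩, rfl⟩
    exact ⟨_, ⟨W, h2 W hW, rfl⟩, fun hi => hWH (projPoints_subset_iff.1 hi.2), rfl⟩
  · rintro _ ⟨W, hW, rfl⟩ _ ⟨U, hU, rfl⟩ hne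
    refine Set.disjoint_left.2 fun p hp hp' => hne ?_
    rw [(h p.1).unique ⟨hW.1, hp⟩ ⟨hU.1, hp'⟩]
  · refine Set.eq_univ_of_forall fun p => ?_
    obtain ⟨W, ⟨hW, hp⟩, -⟩ := h p.1
    exact ⟨_, ⟨W, ⟨hW, fun hle => p.2 (projPoints_subset_iff.2 hle hp)⟩, rfl⟩, hp⟩

theorem affRestrict_inter_image {H : Submodule F V} {L : Set (Set (ℙ F V))}
    (hL : L ⊆ projLines F V) {S : Set (Submodule F V)} (hS : ∀ W ∈ S, ¬ W ≤ H) :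
    affRestrict H L ∩ (fun W : Submodule F V =>
      (Subtype.val ⁻¹' projPoints W : Set (AffPoint H))) '' S =
    (fun W : Submodule F V => (Subtype.val ⁻¹' projPoints W : Set (AffPoint H))) ''
      {W | W ∈ S ∧ projPoints W ∈ L} := by
  ext m
  constructor
  · rintro ⟨⟨l, hl, hli, hm⟩, W, hW, rfl⟩
    obtain ⟨U, hU, rfl⟩ := hL hl
    have hUH : ¬ U ≤ H := fun hle => hli ⟨hL hl, projPoints_subset_iff.2 hle⟩
    obtain rfl := affPart_injOn H (hS W hW) hUH hm
    exact ⟨W, ⟨hW, hl⟩, rfl⟩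
  · rintro ⟨W, ⟨hW, hWL⟩, rfl⟩
    exact ⟨⟨_, hWL, fun hi => hS W hW (projPoints_subset_iff.1 hi.2), rfl⟩, W, hW, rfl⟩

theorem ncard_affRestrict_inter_image {H : Submodule F V} {L : Set (Set (ℙ F V))}
    (hL : L ⊆ projLines F V) {S : Finset (Submodule F V)} (hS : ∀ W ∈ S, ¬ W ≤ H) :
    ((affRestrict H L ∩ (fun W : Submodule F V =>
      (Subtype.val ⁻¹' projPoints W : Set (AffPoint H))) '' (S : Set (Submodule F V))).ncard : ℚ) =
    ∑ W ∈ S, lineIndicator L W := by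
  classical
  rw [affRestrict_inter_image hL (by simpa using hS), Set.InjOn.ncard_image
    ((affPart_injOn H).mono fun W hW => hS W hW.1)]
  have : {W | W ∈ (S : Set (Submodule F V)) ∧ projPoints W ∈ L} =
      (({W ∈ S | projPoints W ∈ L} : Finset _) : Set (Submodule F V)) := by
    ext W
    simp
  rw [this, Set.ncard_coe_finset]
  simp [lineIndicator]

end AffinePart

/-! ### Spreads through a line and the weight on points. -/

section Main

variable {F V : Type*} [Field F] [Finite F] [AddCommGroup V] [Module F V]

variable (F) in
theorem exists_quadratic_extension : ∃ (E : Type) (_ : Field E) (_ : Finite E) (_ : Algebra F E),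
    finrank F E = 2 := by
  obtain ⟨p, hp⟩ := CharP.exists F
  have : Fact p.Prime := ⟨CharP.char_is_prime F p⟩
  exact ⟨FiniteField.Extension F p 2, inferInstance, inferInstance, inferInstance,
    FiniteField.finrank_extension F p 2⟩

theorem exists_spread_containing (hV : finrank F V = 4) {W : Submodule F V}
    (hW : finrank F W = 2) : ∃ S : Finset (Submodule F V), W ∈ S ∧ (∀ U ∈ S, finrank F U = 2) ∧
      ∀ p : ℙ F V, ∃! U, U ∈ S ∧ p ∈ projPoints U := by
  obtain ⟨E, _, _, _, hE⟩ := exists_quadratic_extension F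
  have := Fintype.ofFinite E
  obtain ⟨e, rfl⟩ := exists_eq_verticalLine (E := E) hE hV hW
  exact ⟨regularSpread e 0, mem_regularSpread.2 (.inl rfl),
    fun U hU => finrank_of_mem_regularSpread hE hW hU, existsUnique_mem_regularSpread e 0⟩

open Classical in
/-- The characteristic function of a Cameron-Liebler line class lies in the row space of the
point-line incidence matrix. -/
theorem IsCLLineClass.exists_weight [Fintype (ℙ F V)] (hV : finrank F V = 4)
    {L : Set (Set (ℙ F V))} {x : ℕ} (hL : IsCLLineClass (projLines F V) x L) :
    ∃ (A : ℚ) (b : ℙ F V → ℚ), 0 < A ∧ ∀ W : Submodule F V, finrank F W = 2 →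
      ∑ p with p ∈ projPoints W, b p = A * lineIndicator L W := by
  obtain ⟨E, _, _, _, hE⟩ := exists_quadratic_extension F
  have : FiniteDimensional F V := .of_finrank_pos (by omega)
  have : Finite V := Module.finite_of_finite F
  have := Fintype.ofFinite (Submodule F V)
  have := Fintype.ofFinite E
  have : Finite (E →ₗ[F] E) := Finite.of_injective _ DFunLike.coe_injective
  have := Fintype.ofFinite (E →ₗ[F] E)
  set κ : ℚ := Fintype.card (E →ₗ[F] E) / Fintype.card E with hκ
  have hκ0 : 0 ≤ κ := by positivity
  have hq : (0 : ℚ) < Nat.card F := by exact_mod_cast Nat.card_pos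
  set n : ℚ := ∑ U ∈ Finset.univ.filter (fun U : Submodule F V => finrank F U = 2),
    lineIndicator L U with hn
  -- The weight of `p` is the number of lines of `L` through `p`, corrected by a constant that
  -- cancels `n - κ * x` over the `q + 1` points of a line.
  refine ⟨Nat.card F + κ, fun p => (∑ U ∈ Finset.univ.filter
    (fun U : Submodule F V => finrank F U = 2 ∧ p ∈ projPoints U),
    lineIndicator L U) - (n - κ * x) / (Nat.card F + 1), by positivity, fun W hW => ?_⟩
  have hcard : (({p | p ∈ projPoints W} : Finset (ℙ F V)).card : ℚ) = Nat.card F + 1 := by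
    have := card_projPoints hW
    rw [Nat.card_eq_fintype_card, Fintype.card_subtype] at this
    exact_mod_cast this
  have h1 : ∑ p with p ∈ projPoints W,
      ∑ U ∈ Finset.univ.filter (fun U : Submodule F V => finrank F U = 2 ∧ p ∈ projPoints U),
        lineIndicator L U =
      ∑ U ∈ Finset.univ.filter (fun U : Submodule F V => finrank F U = 2),
        (({p | p ∈ projPoints U ∧ p ∈ projPoints W} : Finset (ℙ F V)).card : ℚ) *
          lineIndicator L U := by
    simp_rw [← Finset.filter_filter, Finset.sum_filter (fun U => _ ∈ projPoints U)]
    rw [Finset.sum_comm]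
    refine Finset.sum_congr rfl fun U _ => ?_
    rw [← Finset.sum_filter, Finset.sum_const, nsmul_eq_mul, Finset.filter_filter]
    congr 3
    ext p
    simp [and_comm]
  have h2 : ∑ U ∈ Finset.univ.filter (fun U : Submodule F V => finrank F U = 2),
        (({p | p ∈ projPoints U ∧ p ∈ projPoints W} : Finset (ℙ F V)).card : ℚ) *
          lineIndicator L U = n + Nat.card F * lineIndicator L W - κ * (x - lineIndicator L W) := by
    rw [hκ, ← hL.sum_skew hE hV hW, hn, ← Finset.filter_filter,
      Finset.sum_filter (fun U => Disjoint U W)]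
    have : (Nat.card F : ℚ) * lineIndicator L W =
        ∑ U ∈ Finset.univ.filter (fun U : Submodule F V => finrank F U = 2),
        if U = W then (Nat.card F : ℚ) * lineIndicator L U else 0 := by
      rw [Finset.sum_ite_eq', if_pos (by simpa using hW)]
    rw [this, ← Finset.sum_add_distrib, ← Finset.sum_sub_distrib]
    refine Finset.sum_congr rfl fun U hU => ?_
    rw [card_inter_projPoints (by simpa using hU) hW]
    split_ifs <;> ring
  rw [Finset.sum_sub_distrib, h1, h2, Finset.sum_const, nsmul_eq_mul, hcard]
  field_simp
  ring

end Main

theorem theorem3p8 {F V : Type*} [Field F] [Finite F] [AddCommGroup V] [Module F V]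
    (hV : Module.finrank F V = 4) (H : Submodule F V) (hH : Module.finrank F H = 3)
    (L : Set (Set (ℙ F V))) (x : ℕ) (hL : IsCLLineClass (projLines F V) x L) :
    IsCLLineClass (affLines H) x (affRestrict H L) ↔ Disjoint L (linesAtInfinity H) := by
  classical
  have : FiniteDimensional F V := .of_finrank_pos (by omega)
  have : Finite V := Module.finite_of_finite F
  have := Fintype.ofFinite (Submodule F V)
  have := Fintype.ofFinite (ℙ F V)
  constructor
  · rintro ⟨-, hA⟩
    rw [Set.disjoint_left]
    rintro _ hl ⟨⟨W, hW, rfl⟩, hWH⟩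
    rw [projPoints_subset_iff] at hWH
    obtain ⟨S, hWS, h2, hS⟩ := exists_spread_containing hV hW
    have h1 := hA _ (isLineSpread_affPart (H := H) h2 hS)
    have h3 := ncard_affRestrict_inter_image (H := H) (S := {U ∈ S | ¬ U ≤ H}) hL.1 (by simp)
    rw [Finset.coe_filter, h1, Finset.sum_filter, ← hL.sum_lineIndicator h2 hS] at h3
    -- Dropping the lines in `H` lowers no other term and loses the `1` contributed by `W`.
    refine h3.not_gt (Finset.sum_lt_sum (fun U _ => ?_) ⟨W, hWS, ?_⟩)
    · unfold lineIndicator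
      split_ifs <;> norm_num
    · simp [hWH, lineIndicator, hl]
  · intro hd
    obtain ⟨A, b, hA, hb⟩ := hL.exists_weight hV
    have hbH : ∀ p ∈ projPoints H, b p = 0 := fun p hp =>
      eq_zero_of_line_sums_eq_zero hH (fun W hW hWH => by
        rw [hb W hW, lineIndicator, if_neg, mul_zero]
        exact fun h => Set.disjoint_left.1 hd h ⟨⟨W, hW, rfl⟩, projPoints_subset_iff.2 hWH⟩) hp
    have htotal : ∀ S : Finset (Submodule F V), (∀ W ∈ S, finrank F W = 2) →
        (∀ p, b p ≠ 0 → ∃! W, W ∈ S ∧ p ∈ projPoints W) →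
        A * ∑ W ∈ S, lineIndicator L W = ∑ p, b p := by
      intro S h2 hS
      rw [← sum_lines_eq_sum_points hS, Finset.mul_sum]
      exact Finset.sum_congr rfl fun W hW => (hb W (h2 W hW)).symm
    -- One projective spread suffices to identify the total weight as `A * x`.
    obtain ⟨W₀, hW₀⟩ := exists_finrank_eq_two (F := F) (V := V) (by omega)
    obtain ⟨S₀, -, h₀, hS₀⟩ := exists_spread_containing hV hW₀
    have htot := htotal S₀ h₀ fun p _ => hS₀ p
    rw [hL.sum_lineIndicator h₀ hS₀] at htot
    refine ⟨fun m ⟨l, hl, h⟩ => ⟨l, hL.1 hl, h⟩, fun S hS => ?_⟩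
    -- The projective closures of the lines of `S`; they need not be disjoint on `H`.
    let S' : Finset (Submodule F V) :=
      {W | finrank F W = 2 ∧ ¬ W ≤ H ∧ (Subtype.val ⁻¹' projPoints W : Set (AffPoint H)) ∈ S}
    have hS' : ∀ W, W ∈ S' ↔ finrank F W = 2 ∧ ¬ W ≤ H ∧
        (Subtype.val ⁻¹' projPoints W : Set (AffPoint H)) ∈ S := by
      simp [S']
    have himage : (fun W : Submodule F V =>
        (Subtype.val ⁻¹' projPoints W : Set (AffPoint H))) '' (S' : Set (Submodule F V)) = S := by
      ext m
      constructor
      · rintro ⟨W, hW, rfl⟩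
        exact ((hS' W).1 hW).2.2
      · intro hm
        obtain ⟨_, ⟨W, hW, rfl⟩, hi, rfl⟩ := hS.1 hm
        exact ⟨W, (hS' W).2 ⟨hW, fun hle => hi ⟨⟨W, hW, rfl⟩, projPoints_subset_iff.2 hle⟩, hm⟩,
          rfl⟩
    have h1 := htotal S' (fun W hW => ((hS' W).1 hW).1) (fun p hp => by
      have hpH : p ∉ projPoints H := mt (hbH p) hp
      have hmem : (⟨p, hpH⟩ : AffPoint H) ∈ ⋃₀ S := hS.2.2 ▸ Set.mem_univ _
      rw [← himage] at hmem
      obtain ⟨_, ⟨W, hW, rfl⟩, hpW⟩ := hmem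
      refine ⟨W, ⟨hW, hpW⟩, ?_⟩
      rintro U ⟨hU, hpU⟩
      have hU' := (hS' U).1 hU
      have hW' := (hS' W).1 hW
      refine affPart_injOn H hU'.2.1 hW'.2.1 (hS.2.1.elim hU'.2.2 hW'.2.2 ?_)
      exact fun hdis => Set.disjoint_left.1 hdis (show (⟨p, hpH⟩ : AffPoint H) ∈ _ from hpU) hpW)
    have h3 := ncard_affRestrict_inter_image (H := H) (S := S') hL.1
      (fun W hW => ((hS' W).1 hW).2.1)
    rw [himage] at h3
    rw [← h3, ← htot] at h1
    exact_mod_cast mul_left_cancel₀ hA.ne' h1
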